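/- Let $h$ be a formal variable, $K=\mathbb{C}[[h]]$, $q^r=e^{rh/2}\in K$ for $r\in\mathbb{C}$ (so $q=e^{h/2}$), and $[m]_q=\frac{q^m-q^{-m}}{q-q^{-1}}\in K$, $[a]_q!=[a]_q\cdots[1]_q$. Let $U_h(sl_2)$ be the topological $K$-algebra topologically generated (in the $h$-adic topology) by $H,X_+,X_-$ with relations $$[H,X_\pm]=\pm 2X_\pm,\qquad [X_+,X_-]=\frac{q^H-q^{-H}}{q-q^{-1}},$$ and, in the $h$-adically completed tensor square of $U_h(sl_2)$, let $$R=\sum_{a\ge 0}\frac{(q-q^{-1})^a}{[a]_q!}\,q^{-a(a+1)/2}\exp\!\Big(\tfrac h4\big[H\otimes H+a(H\otimes 1-1\otimes H)\big]\Big)(X_+^a\otimes X_-^a).$$ Let $\widetilde V_1$ be the free $K$-module with basis $v_0,v_1$, made into a (topological) $U_h(sl_2)$-module by $Hv_0=v_0$, $Hv_1=-v_1$, $X_+v_0=0$, $X_+v_1=v_0$, $X_-v_0=v_1$, $X_-v_1=0$ (this is the case $n=1$ of $X_+v_i=[n+1-i]_qv_{i-1}$, $X_-v_i=[i+1]_qv_{i+1}$,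 $Hv_i=(n-2i)v_i$). Let $\tau(v\otimes w)=w\otimes v$. For $c\in\mathbb{C}$ put $\gamma=e^{2c}$, let $\alpha:\widetilde V_1\to\widetilde V_1$ be the $K$-linear map $\alpha(v_i)=\gamma^{-i}v_i$, and let $$B=\tau\circ R,\qquad B_\alpha=\alpha^{\otimes 2}\circ\tau\circ R$$ on $\widetilde V_1\otimes_K\widetilde V_1$. (1) For every $c\in\mathbb{C}$, $B_\alpha$ is a solution of the Hom-Yang-Baxter equation for $(\widetilde V_1,\alpha)$: it commutes with $\alpha^{\otimes 2}$ and satisfies $$(\alpha\otimes B_\alpha)(B_\alpha\otimes\alpha)(\alpha\otimes B_\alpha)=(B_\alpha\otimes\alpha)(\alpha\otimes B_\alpha)(B_\alpha\otimes\alpha).$$ With respect to the ordered basis $v_0\otimes v_0,\ v_0\otimes v_1,\ v_1\otimes v_0,\ v_1\otimes v_1$ (columns being the coordinates of the images of the basis vectors), it has the matrix $$B_\alpha=q^{-1/2}\begin{pmatrix} q&0&0&0\\ 0&0&\gamma^{-1}&0\\ 0&\gamma^{-1}&\gamma^{-1}(q-q^{-1})&0\\ 0&0&0&\gamma^{-2}q\end{pmatrix}.$$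 (2) The operators $B_\alpha$ form a one-parameter family deforming $B$: for $c=0$ (that is, $\gamma=1$) one has $B_\alpha=B$, the operator $B$ is a solution of the Yang-Baxter equation $(B\otimes\mathrm{Id})(\mathrm{Id}\otimes B)(B\otimes\mathrm{Id})=(\mathrm{Id}\otimes B)(B\otimes\mathrm{Id})(\mathrm{Id}\otimes B)$, and with respect to the same basis $$B=q^{-1/2}\begin{pmatrix} q&0&0&0\\ 0&0&1&0\\ 0&1&q-q^{-1}&0\\ 0&0&0&q\end{pmatrix}.$$ -/

import Mathlib

open scoped TensorProduct

noncomputable section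

namespace HomQuantum

/-- The ground ring `ℂ[[h]]`; the variable `h` is `PowerSeries.X`. -/
abbrev K : Type := PowerSeries ℂ

/-- The ideal `(h)` of `ℂ[[h]]`. -/
abbrev hIdeal : Ideal K := Ideal.span {(PowerSeries.X : K)}

/-! ### The `q`-symbols, `q = e^{h/2}` -/

/-- `q ^ r = e^{r h / 2}` in `ℂ[[h]]`, for a complex exponent `r`. -/
def qPow (r : ℂ) : K := PowerSeries.rescale (r / 2) (PowerSeries.exp ℂ)

theorem coeff_qPow (r : ℂ) (k : ℕ) :
    PowerSeries.coeff k (qPow r) = (r / 2) ^ k / (k.factorial : ℂ) := by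
  simp [qPow, PowerSeries.coeff_rescale, div_eq_mul_inv]

theorem qPow_add (r s : ℂ) : qPow (r + s) = qPow r * qPow s := by
  rw [qPow, qPow, qPow, PowerSeries.exp_mul_exp_eq_exp_add, add_div]

theorem qPow_zero : qPow 0 = 1 := by
  ext k
  rw [coeff_qPow, PowerSeries.coeff_one]
  rcases k with _ | k <;> simp

/-- `q - q⁻¹`. -/
def qDiff : K := qPow 1 - qPow (-1)

/-- Division by `h`: drop the constant term and shift the coefficients. -/
def divH {A : Type*} [Semiring A] (f : PowerSeries A) : PowerSeries A :=
  PowerSeries.mk fun k => PowerSeries.coeff (k + 1) f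

theorem X_mul_divH {A : Type*} [Semiring A] (f : PowerSeries A)
    (hf : PowerSeries.coeff 0 f = 0) : PowerSeries.X * divH f = f := by
  ext k
  rcases k with _ | k
  · rw [hf]; simp
  · simp [divH, PowerSeries.coeff_succ_X_mul]

theorem coeff_zero_qDiff : PowerSeries.coeff 0 qDiff = 0 := by
  simp only [qDiff, map_sub, coeff_qPow]; simp

theorem coeff_zero_divH_qDiff : PowerSeries.constantCoeff (divH qDiff) = 1 := by
  rw [← PowerSeries.coeff_zero_eq_constantCoeff_apply, divH, PowerSeries.coeff_mk, qDiff, map_sub,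
    coeff_qPow, coeff_qPow]
  norm_num

theorem qDiff_ne_zero : qDiff ≠ 0 := by
  intro h
  have := coeff_zero_divH_qDiff
  rw [h] at this
  simp [divH] at this

/-- The `q`-integer `[m]_q = (q^m - q^{-m}) / (q - q⁻¹)`, `m ∈ ℤ`.  Both numerator and denominator
are divisible by `h`, and the denominator divided by `h` is invertible in `ℂ[[h]]`. -/
def qInt (m : ℤ) : K := divH (qPow m - qPow (-m)) * (divH qDiff)⁻¹

theorem qDiff_mul_qInt (m : ℤ) : qDiff * qInt m = qPow m - qPow (-m) := by
  have h1 := X_mul_divH (qPow m - qPow (-m)) (by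
    rw [map_sub, coeff_qPow, coeff_qPow]; norm_num)
  have h2 := X_mul_divH qDiff coeff_zero_qDiff
  have h3 : divH qDiff * (divH qDiff)⁻¹ = 1 :=
    PowerSeries.mul_inv_cancel _ (by rw [coeff_zero_divH_qDiff]; exact one_ne_zero)
  rw [qInt]
  calc _ = (PowerSeries.X * divH qDiff) * (divH (qPow m - qPow (-m)) * (divH qDiff)⁻¹) := by rw [h2]
    _ = (PowerSeries.X * divH (qPow m - qPow (-m))) * (divH qDiff * (divH qDiff)⁻¹) := by ring
    _ = _ := by rw [h3, h1, mul_one]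

/-- The `q`-factorial `[a]_q! = [a]_q ⋯ [1]_q`. -/
def qFact (a : ℕ) : K := ∏ k ∈ Finset.range a, qInt ((k : ℤ) + 1)

/-- `[a]_q!` is a unit of `ℂ[[h]]`, so that `(qFact a)⁻¹` is a genuine inverse. -/
theorem constantCoeff_qFact (a : ℕ) :
    PowerSeries.constantCoeff (qFact a) = (a.factorial : ℂ) := by
  have h (m : ℤ) : PowerSeries.constantCoeff (qInt m) = (m : ℂ) := by
    rw [qInt, map_mul, PowerSeries.constantCoeff_inv, coeff_zero_divH_qDiff,
      ← PowerSeries.coeff_zero_eq_constantCoeff_apply, divH, PowerSeries.coeff_mk, map_sub,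
      coeff_qPow, coeff_qPow]
    norm_num
    ring
  rw [qFact, map_prod]
  induction a with
  | zero => simp
  | succ a ih => rw [Finset.prod_range_succ, ih, h, Nat.factorial_succ]; push_cast; ring

/-! ### The topological algebra `U_h(sl_2)` -/

/-- The generators `H`, `X_+`, `X_-`. -/
inductive Gen : Type
  | H
  | Xp
  | Xm

/-- The free algebra `ℂ⟨H, X_+, X_-⟩`. -/
abbrev FreeA : Type := FreeAlgebra ℂ Gen

/-- The free topological `ℂ[[h]]`-algebra `ℂ⟨H, X_+, X_-⟩[[h]]`. -/
abbrev FreeTop : Type := PowerSeries FreeA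

instance : Algebra K FreeTop :=
  RingHom.toAlgebra' (PowerSeries.map (algebraMap ℂ FreeA)) (by
    intro c x
    ext k
    rw [PowerSeries.coeff_mul, PowerSeries.coeff_mul, ← Finset.Nat.sum_antidiagonal_swap]
    refine Finset.sum_congr rfl fun p _ => ?_
    simp [Algebra.commutes])

theorem algebraMap_freeTop (c : K) :
    algebraMap K FreeTop c = PowerSeries.map (algebraMap ℂ FreeA) c := rfl

/-- A generator, as an element of `ℂ⟨H, X_+, X_-⟩[[h]]`. -/
def gen (g : Gen) : FreeTop := PowerSeries.C (FreeAlgebra.ι ℂ g)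

/-- `q ^ (r H) = e^{r h H / 2} = ∑_k (r h / 2)^k H^k / k!` in `ℂ⟨H, X_+, X_-⟩[[h]]`. -/
def qPowH (r : ℂ) : FreeTop :=
  PowerSeries.mk fun k => ((r / 2) ^ k / (k.factorial : ℂ)) • (FreeAlgebra.ι ℂ Gen.H) ^ k

/-- `(q^H - q^{-H}) / (q - q⁻¹)` in `ℂ⟨H, X_+, X_-⟩[[h]]`: numerator and denominator are divided
by `h`, after which the denominator is a unit of `ℂ[[h]]`. -/
def qIntH : FreeTop := (divH qDiff)⁻¹ • divH (qPowH 1 - qPowH (-1))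

theorem qDiff_smul_qIntH : qDiff • qIntH = qPowH 1 - qPowH (-1) := by
  have h1 := X_mul_divH (qPowH 1 - qPowH (-1)) (by simp [qPowH])
  have h2 := X_mul_divH qDiff coeff_zero_qDiff
  have h3 : divH qDiff * (divH qDiff)⁻¹ = 1 :=
    PowerSeries.mul_inv_cancel _ (by rw [coeff_zero_divH_qDiff]; exact one_ne_zero)
  have h4 : qDiff * (divH qDiff)⁻¹ = PowerSeries.X := by
    calc _ = PowerSeries.X * divH qDiff * (divH qDiff)⁻¹ := by rw [h2]
      _ = _ := by rw [mul_assoc, h3, mul_one]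
  rw [qIntH, smul_smul, h4, Algebra.smul_def, algebraMap_freeTop, PowerSeries.map_X, h1]

/-- The two-sided ideal generated by the defining relations
`[H, X_±] = ± 2 X_±` and `[X_+, X_-] = (q^H - q^{-H}) / (q - q⁻¹)`. -/
def relIdeal : TwoSidedIdeal FreeTop :=
  TwoSidedIdeal.span
    {gen .H * gen .Xp - gen .Xp * gen .H - 2 * gen .Xp,
      gen .H * gen .Xm - gen .Xm * gen .H + 2 * gen .Xm,
      gen .Xp * gen .Xm - gen .Xm * gen .Xp - qIntH}

/-- `x` and `y` are congruent modulo the closure of `relIdeal` in the `h`-adic topology: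
for every `N`, `x - y` differs from an element of `relIdeal` by a multiple of `h ^ N`. -/
def ClosedRel (x y : FreeTop) : Prop :=
  ∀ N : ℕ, ∃ z ∈ relIdeal, ∀ k < N, PowerSeries.coeff k (x - y - z) = 0

/-- `U_h(sl_2)`: the topological `ℂ[[h]]`-algebra topologically generated by `H`, `X_+`, `X_-` with
the defining relations, i.e. the quotient of `ℂ⟨H, X_+, X_-⟩[[h]]` by the `h`-adic closure of the
two-sided ideal that they generate. -/
def Uh : Type := RingQuot ClosedRel

instance : Ring Uh := inferInstanceAs (Ring (RingQuot ClosedRel))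

instance : Algebra K Uh := inferInstanceAs (Algebra K (RingQuot ClosedRel))

/-- The quotient map onto `U_h(sl_2)`. -/
def Uh.mk : FreeTop →ₐ[K] Uh := RingQuot.mkAlgHom K ClosedRel

/-- The generators of `U_h(sl_2)`. -/
def Uh.of (g : Gen) : Uh := Uh.mk (gen g)

/-! ### The universal `R`-matrix in the completed tensor square -/

/-- The completed tensor square: the `h`-adic completion of `U_h(sl_2) ⊗ U_h(sl_2)`. -/
abbrev UhTensor : Type := AdicCompletion hIdeal (Uh ⊗[K] Uh)

/-- The coefficient `(q - q⁻¹)^a / [a]_q! * q^{-a(a+1)/2}`. -/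
def rCoeff (a : ℕ) : K :=
  qDiff ^ a * (qFact a)⁻¹ * qPow (-((a : ℂ) * ((a : ℂ) + 1) / 2))

/-- `H ⊗ H + a (H ⊗ 1 - 1 ⊗ H)`. -/
def rExponent (a : ℕ) : Uh ⊗[K] Uh :=
  Uh.of .H ⊗ₜ[K] Uh.of .H + a • (Uh.of .H ⊗ₜ[K] 1 - 1 ⊗ₜ[K] Uh.of .H)

/-- The `N`-th partial sum of the exponential series of
`(h/4) (H ⊗ H + a (H ⊗ 1 - 1 ⊗ H))`. -/
def rExpPartial (a N : ℕ) : Uh ⊗[K] Uh :=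
  ∑ m ∈ Finset.range N,
    ((PowerSeries.X : K) ^ m * PowerSeries.C (1 / (4 ^ m * (m.factorial : ℂ)))) • rExponent a ^ m

/-- The partial sums, over `a < N`, of the series that defines `R`, with the exponentials truncated
at order `h ^ N`. -/
def rPartial (N : ℕ) : Uh ⊗[K] Uh :=
  ∑ a ∈ Finset.range N,
    rCoeff a • (rExpPartial a N * ((Uh.of .Xp ^ a) ⊗ₜ[K] (Uh.of .Xm ^ a)))

theorem rCoeff_mem (a : ℕ) : rCoeff a ∈ hIdeal ^ a := by
  have : qDiff ∈ hIdeal := by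
    rw [← X_mul_divH qDiff coeff_zero_qDiff]
    exact Ideal.mul_mem_right _ _ (Ideal.mem_span_singleton_self _)
  exact Ideal.mul_mem_right _ _ (Ideal.mul_mem_right _ _ (Ideal.pow_mem_pow this a))

/-- The partial sums of `R` are `h`-adically Cauchy. -/
theorem rPartial_cauchy (N : ℕ) :
    rPartial N ≡ rPartial (N + 1) [SMOD (hIdeal ^ N • ⊤ : Submodule K (Uh ⊗[K] Uh))] := by
  symm
  rw [SModEq.sub_mem, rPartial, rPartial, Finset.sum_range_succ, add_sub_right_comm,
    ← Finset.sum_sub_distrib]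
  refine add_mem (Submodule.sum_mem _ fun a _ => ?_)
    (Submodule.smul_mem_smul (rCoeff_mem N) trivial)
  rw [← smul_sub, ← sub_mul, rExpPartial, rExpPartial, Finset.sum_range_succ, add_sub_cancel_left,
    smul_mul_assoc]
  exact Submodule.smul_mem _ _ (Submodule.smul_mem_smul (Ideal.mul_mem_right _ _
    (Ideal.pow_mem_pow (Ideal.mem_span_singleton_self _) N)) trivial)

/-- The universal `R`-matrix
`R = ∑_{a ≥ 0} (q - q⁻¹)^a / [a]_q! q^{-a(a+1)/2}
  exp((h/4) (H ⊗ H + a (H ⊗ 1 - 1 ⊗ H))) (X_+^a ⊗ X_-^a)`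
of `U_h(sl_2)`, in the completed tensor square. -/
def universalR : UhTensor :=
  AdicCompletion.mk hIdeal _ (AdicCompletion.AdicCauchySequence.mk hIdeal _ rPartial rPartial_cauchy)


/-! ### Evaluation of `ℂ⟨H, X_+, X_-⟩[[h]]` in matrices over `ℂ[[h]]` -/

/-- Entrywise congruence of matrices modulo `h ^ N`. -/
def MatCong {n : Type} (N : ℕ) (A B : Matrix n n K) : Prop :=
  ∀ i j, (PowerSeries.X : K) ^ N ∣ A i j - B i j

theorem MatCong.symm {n : Type} {N : ℕ} {A B : Matrix n n K} (h : MatCong N A B) : MatCong N B A :=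
  fun i j => by rw [dvd_sub_comm]; exact h i j

theorem MatCong.trans {n : Type} {N : ℕ} {A B D : Matrix n n K} (h : MatCong N A B) (h' : MatCong N B D) :
    MatCong N A D :=
  fun i j => by simpa using dvd_add (h i j) (h' i j)

theorem MatCong.add {n : Type} {N : ℕ} {A B A' B' : Matrix n n K} (h : MatCong N A B)
    (h' : MatCong N A' B') : MatCong N (A + A') (B + B') :=
  fun i j => by
    have := dvd_add (h i j) (h' i j)
    rwa [sub_add_sub_comm] at this

theorem MatCong.mul {n : Type} [Fintype n] {N : ℕ} {A B A' B' : Matrix n n K} (h : MatCong N A B)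
    (h' : MatCong N A' B') : MatCong N (A * A') (B * B') := fun i j => by
  rw [Matrix.mul_apply, Matrix.mul_apply, ← Finset.sum_sub_distrib]
  refine Finset.dvd_sum fun k _ => ?_
  have : A i k * A' k j - B i k * B' k j
      = (A i k - B i k) * A' k j + B i k * (A' k j - B' k j) := by ring
  rw [this]
  exact dvd_add (Dvd.dvd.mul_right (h i k) _) (Dvd.dvd.mul_left (h' k j) _)

theorem matrix_eq_of_cong {n : Type} {A B : Matrix n n K} (h : ∀ N, MatCong N A B) : A = B := by
  ext i j k
  have := PowerSeries.X_pow_dvd_iff.mp (h (k + 1) i j) k (Nat.lt_succ_self k)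
  rwa [map_sub, sub_eq_zero] at this

/-- The partial sum `∑_{k < N} h^k φ(f_k)`, for `f = ∑_k f_k h^k`. -/
def evalPartial {n : Type} [Fintype n] [DecidableEq n] (φ : FreeA →ₐ[ℂ] Matrix n n K) (N : ℕ) (f : FreeTop) : Matrix n n K :=
  ∑ k ∈ Finset.range N, (PowerSeries.X : K) ^ k • φ (PowerSeries.coeff k f)

/-- The matrix `∑_k h^k φ(f_k)` over `ℂ[[h]]`, for `f = ∑_k f_k h^k`: the coefficient at `h^N`
of an entry is read off from the partial sum over `k ≤ N`. -/
def evalFun {n : Type} [Fintype n] [DecidableEq n] (φ : FreeA →ₐ[ℂ] Matrix n n K) (f : FreeTop) : Matrix n n K :=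
  Matrix.of fun i j =>
    PowerSeries.mk fun N => PowerSeries.coeff N (evalPartial φ (N + 1) f i j)

theorem evalPartial_cong {n : Type} [Fintype n] [DecidableEq n] (φ : FreeA →ₐ[ℂ] Matrix n n K) (f : FreeTop) {M N : ℕ} (h : N ≤ M) :
    MatCong N (evalPartial φ M f) (evalPartial φ N f) := by
  intro i j
  obtain ⟨d, rfl⟩ := Nat.exists_eq_add_of_le h
  rw [evalPartial, evalPartial, Finset.sum_range_add, Matrix.add_apply, add_sub_cancel_left,
    Matrix.sum_apply]
  refine Finset.dvd_sum fun k _ => ?_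
  rw [Matrix.smul_apply, smul_eq_mul, pow_add, mul_assoc]
  exact dvd_mul_right _ _

theorem evalFun_cong {n : Type} [Fintype n] [DecidableEq n] (φ : FreeA →ₐ[ℂ] Matrix n n K) (f : FreeTop) (N : ℕ) :
    MatCong N (evalFun φ f) (evalPartial φ N f) := by
  intro i j
  rw [PowerSeries.X_pow_dvd_iff]
  intro m hm
  have := PowerSeries.X_pow_dvd_iff.mp
    (evalPartial_cong φ f (Nat.succ_le_of_lt hm) i j) m (Nat.lt_succ_self m)
  rw [map_sub, sub_eq_zero] at this ⊢
  rw [this, evalFun, Matrix.of_apply, PowerSeries.coeff_mk]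

theorem evalPartial_mul {n : Type} [Fintype n] [DecidableEq n] (φ : FreeA →ₐ[ℂ] Matrix n n K) (f g : FreeTop) (N : ℕ) :
    MatCong N (evalPartial φ N (f * g)) (evalPartial φ N f * evalPartial φ N g) := by
  set F : ℕ × ℕ → Matrix n n K := fun p => (PowerSeries.X : K) ^ (p.1 + p.2) •
    (φ (PowerSeries.coeff p.1 f) * φ (PowerSeries.coeff p.2 g)) with hF
  have h1 : evalPartial φ N (f * g)
      = ∑ p ∈ (Finset.range N ×ˢ Finset.range N) with p.1 + p.2 < N, F p := by
    rw [evalPartial]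
    have : ∀ k ∈ Finset.range N, (PowerSeries.X : K) ^ k • φ (PowerSeries.coeff k (f * g))
        = ∑ p ∈ (Finset.range N ×ˢ Finset.range N) with p.1 + p.2 = k, F p := by
      intro k hk
      rw [PowerSeries.coeff_mul, map_sum, Finset.smul_sum]
      have hs : Finset.HasAntidiagonal.antidiagonal k
          = (Finset.range N ×ˢ Finset.range N).filter (fun p => p.1 + p.2 = k) := by
        ext p
        simp only [Finset.HasAntidiagonal.mem_antidiagonal, Finset.mem_filter, Finset.mem_product,
          Finset.mem_range] at hk ⊢
        omega
      rw [← hs]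
      refine Finset.sum_congr rfl fun p hp => ?_
      rw [hF, map_mul, ← Finset.HasAntidiagonal.mem_antidiagonal.mp hp]
    rw [Finset.sum_congr rfl this,
      ← Finset.sum_fiberwise_of_maps_to (t := Finset.range N) (g := fun p : ℕ × ℕ => p.1 + p.2)
        (by intro p hp; simpa using (Finset.mem_filter.mp hp).2)]
    refine Finset.sum_congr rfl fun k hk => Finset.sum_congr ?_ fun _ _ => rfl
    ext p
    simp only [Finset.mem_filter, Finset.mem_product, Finset.mem_range] at hk ⊢
    omega
  have h2 : evalPartial φ N f * evalPartial φ N g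
      = ∑ p ∈ Finset.range N ×ˢ Finset.range N, F p := by
    rw [evalPartial, evalPartial, Finset.sum_mul_sum, Finset.sum_product]
    refine Finset.sum_congr rfl fun a _ => Finset.sum_congr rfl fun b _ => ?_
    simp only [hF]
    rw [smul_mul_smul_comm, pow_add]
  apply MatCong.symm
  intro i j
  rw [h1, h2, ← Finset.sum_filter_add_sum_filter_not (Finset.range N ×ˢ Finset.range N)
    (fun p => p.1 + p.2 < N), Matrix.add_apply, add_sub_cancel_left, Matrix.sum_apply]
  refine Finset.dvd_sum fun p hp => ?_
  simp only [hF]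
  rw [Matrix.smul_apply, smul_eq_mul]
  exact Dvd.dvd.mul_right (pow_dvd_pow _ (not_lt.mp (Finset.mem_filter.mp hp).2)) _

theorem evalFun_mul {n : Type} [Fintype n] [DecidableEq n] (φ : FreeA →ₐ[ℂ] Matrix n n K) (f g : FreeTop) :
    evalFun φ (f * g) = evalFun φ f * evalFun φ g :=
  matrix_eq_of_cong fun N => (evalFun_cong φ _ N).trans ((evalPartial_mul φ f g N).trans
    ((evalFun_cong φ f N).mul (evalFun_cong φ g N)).symm)

theorem evalFun_add {n : Type} [Fintype n] [DecidableEq n] (φ : FreeA →ₐ[ℂ] Matrix n n K) (f g : FreeTop) :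
    evalFun φ (f + g) = evalFun φ f + evalFun φ g := by
  refine matrix_eq_of_cong fun N => (evalFun_cong φ _ N).trans ?_
  have : evalPartial φ N (f + g) = evalPartial φ N f + evalPartial φ N g := by
    simp [evalPartial, Finset.sum_add_distrib]
  rw [this]
  exact ((evalFun_cong φ f N).add (evalFun_cong φ g N)).symm

/-- `evalFun` on a series whose coefficients are mapped to scalar multiples of `M k`. -/
theorem evalFun_apply {n : Type} [Fintype n] [DecidableEq n] (φ : FreeA →ₐ[ℂ] Matrix n n K) (f : FreeTop) (i j : n) (c : ℕ → ℂ)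
    (h : ∀ k, φ (PowerSeries.coeff k f) i j = PowerSeries.C (c k)) :
    evalFun φ f i j = PowerSeries.mk c := by
  ext N
  rw [evalFun, Matrix.of_apply, PowerSeries.coeff_mk, PowerSeries.coeff_mk, evalPartial,
    Matrix.sum_apply, map_sum, Finset.sum_range_succ, Finset.sum_eq_zero, zero_add,
    Matrix.smul_apply, h, smul_eq_mul, PowerSeries.coeff_X_pow_mul']
  · simp
  · intro k hk
    have hk := Finset.mem_range.mp hk
    rw [Matrix.smul_apply, h, smul_eq_mul, PowerSeries.coeff_X_pow_mul', if_pos hk.le,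
      PowerSeries.coeff_C, if_neg (by omega)]

theorem evalFun_algebraMap {n : Type} [Fintype n] [DecidableEq n] (φ : FreeA →ₐ[ℂ] Matrix n n K) (c : K) :
    evalFun φ (algebraMap K FreeTop c) = algebraMap K (Matrix n n K) c := by
  have hφ (k : ℕ) (i j : n) : φ (PowerSeries.coeff k (algebraMap K FreeTop c)) i j
      = PowerSeries.C (if i = j then PowerSeries.coeff k c else 0) := by
    rw [algebraMap_freeTop, PowerSeries.coeff_map, AlgHom.commutes, Matrix.algebraMap_matrix_apply]
    split_ifs <;> simp
  ext1 i j
  rw [evalFun_apply φ _ i j _ (fun k => hφ k i j), Matrix.algebraMap_matrix_apply]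
  ext k
  split_ifs <;> simp

/-- The extension of a homomorphism `ℂ⟨H, X_+, X_-⟩ → Mat(ℂ[[h]])` to the `h`-adically continuous
homomorphism `∑_k f_k h^k ↦ ∑_k h^k φ(f_k)` of `ℂ[[h]]`-algebras. -/
def evalHom {n : Type} [Fintype n] [DecidableEq n] (φ : FreeA →ₐ[ℂ] Matrix n n K) : FreeTop →ₐ[K] Matrix n n K where
  toFun := evalFun φ
  map_one' := by rw [← map_one (algebraMap K FreeTop), evalFun_algebraMap, map_one]
  map_mul' := evalFun_mul φ
  map_zero' := by rw [← map_zero (algebraMap K FreeTop), evalFun_algebraMap, map_zero]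
  map_add' := evalFun_add φ
  commutes' := evalFun_algebraMap φ

theorem evalHom_gen {n : Type} [Fintype n] [DecidableEq n] (φ : FreeA →ₐ[ℂ] Matrix n n K) (g : Gen) :
    evalHom φ (gen g) = φ (FreeAlgebra.ι ℂ g) := by
  refine matrix_eq_of_cong fun N => ?_
  have h : MatCong (N + 1) (evalHom φ (gen g)) (φ (FreeAlgebra.ι ℂ g)) := by
    refine (evalFun_cong φ (gen g) (N + 1)).trans fun i j => ?_
    rw [evalPartial, Finset.sum_range_succ', Finset.sum_eq_zero]
    · simp [gen]
    · intro k _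
      simp [gen]
  exact fun i j => (pow_dvd_pow _ (Nat.le_succ N)).trans (h i j)

/-- A continuous homomorphism that respects the defining relations respects their closure. -/
theorem evalHom_closedRel {n : Type} [Fintype n] [DecidableEq n] (φ : FreeA →ₐ[ℂ] Matrix n n K)
    (h : ∀ z ∈ relIdeal, evalHom φ z = 0) ⦃x y : FreeTop⦄ (hxy : ClosedRel x y) :
    evalHom φ x = evalHom φ y := by
  rw [← sub_eq_zero, ← map_sub]
  refine matrix_eq_of_cong fun N => ?_
  obtain ⟨z, hz, hk⟩ := hxy N
  have : evalHom φ (x - y) = evalHom φ (x - y - z) := by rw [map_sub _ (x - y), h z hz, sub_zero]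
  rw [this]
  refine (evalFun_cong φ _ N).trans ?_
  rw [evalPartial, Finset.sum_eq_zero]
  · intro i j; simp
  · intro k hk'
    rw [hk k (Finset.mem_range.mp hk'), map_zero, smul_zero]

/-! ### The modules `Ṽ_n` -/

/-- `Ṽ_n`: the free `ℂ[[h]]`-module with basis `v_0, …, v_n`. -/
abbrev V (n : ℕ) : Type := Fin (n + 1) → K

/-- The basis `v_0, …, v_n` of `Ṽ_n`. -/
def vBasis (n : ℕ) : Module.Basis (Fin (n + 1)) K (V n) := Pi.basisFun K _

/-- The matrices of the generators on `Ṽ_n`: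
`H v_j = (n - 2j) v_j`, `X_+ v_j = [n + 1 - j]_q v_{j-1}`, `X_- v_j = [j + 1]_q v_{j+1}`. -/
def genMatrix (n : ℕ) : Gen → Matrix (Fin (n + 1)) (Fin (n + 1)) K
  | .H => Matrix.diagonal fun j => PowerSeries.C ((n : ℂ) - 2 * ((j : ℕ) : ℂ))
  | .Xp => Matrix.of fun i j =>
      if (i : ℕ) + 1 = (j : ℕ) then qInt ((n : ℤ) + 1 - ((j : ℕ) : ℤ)) else 0
  | .Xm => Matrix.of fun i j => if (i : ℕ) = (j : ℕ) + 1 then qInt (((j : ℕ) : ℤ) + 1) else 0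

/-- The action of `ℂ⟨H, X_+, X_-⟩[[h]]` by the matrices `genMatrix`. -/
def freeAction (n : ℕ) : FreeTop →ₐ[K] Matrix (Fin (n + 1)) (Fin (n + 1)) K :=
  evalHom (FreeAlgebra.lift ℂ (genMatrix n))

theorem freeAction_gen (n : ℕ) (g : Gen) : freeAction n (gen g) = genMatrix n g := by
  rw [freeAction, evalHom_gen, FreeAlgebra.lift_ι_apply]

theorem freeAction_qPowH (n : ℕ) (r : ℂ) : freeAction n (qPowH r)
    = Matrix.diagonal fun j : Fin (n + 1) => qPow (r * ((n : ℂ) - 2 * ((j : ℕ) : ℂ))) := by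
  ext1 i j
  refine (evalFun_apply _ _ i j (fun k => if i = j then
    (r * ((n : ℂ) - 2 * ((i : ℕ) : ℂ)) / 2) ^ k / (k.factorial : ℂ) else 0) ?_).trans ?_
  · intro k
    rw [qPowH, PowerSeries.coeff_mk, map_smul, map_pow, FreeAlgebra.lift_ι_apply, genMatrix,
      Matrix.diagonal_pow, Matrix.smul_apply, Matrix.diagonal_apply]
    split_ifs
    · rw [Pi.pow_apply, ← map_pow, PowerSeries.smul_eq_C_mul, ← map_mul, div_mul_eq_mul_div,
        ← mul_pow, div_mul_eq_mul_div]
    · simp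
  · rw [Matrix.diagonal_apply]
    ext k
    split_ifs
    · rw [PowerSeries.coeff_mk, coeff_qPow]
    · simp

theorem freeAction_qIntH (n : ℕ) : freeAction n qIntH
    = Matrix.diagonal fun j : Fin (n + 1) => qInt ((n : ℤ) - 2 * ((j : ℕ) : ℤ)) := by
  have h : qDiff • freeAction n qIntH = qDiff •
      Matrix.diagonal fun j : Fin (n + 1) => qInt ((n : ℤ) - 2 * ((j : ℕ) : ℤ)) := by
    rw [← map_smul, qDiff_smul_qIntH, map_sub, freeAction_qPowH, freeAction_qPowH,
      Matrix.diagonal_sub, ← Matrix.diagonal_smul]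
    congr 1
    funext j
    rw [Pi.smul_apply, smul_eq_mul, qDiff_mul_qInt]
    push_cast
    simp
  ext1 i j
  have := congrFun (congrFun h i) j
  simp only [Matrix.smul_apply, smul_eq_mul] at this
  exact mul_left_cancel₀ qDiff_ne_zero this

theorem qInt_zero : qInt 0 = 0 :=
  mul_left_cancel₀ qDiff_ne_zero (by rw [qDiff_mul_qInt]; simp)

/-- `[a + 1] [b] - [a] [b + 1] = [b - a]`. -/
theorem qInt_identity (a b : ℤ) :
    qInt (a + 1) * qInt b - qInt a * qInt (b + 1) = qInt (b - a) := by
  refine mul_left_cancel₀ (mul_ne_zero qDiff_ne_zero qDiff_ne_zero) ?_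
  have e : qDiff * qDiff * (qInt (a + 1) * qInt b - qInt a * qInt (b + 1))
      = (qDiff * qInt (a + 1)) * (qDiff * qInt b) - (qDiff * qInt a) * (qDiff * qInt (b + 1)) := by
    ring
  rw [e, mul_assoc qDiff qDiff, qDiff_mul_qInt, qDiff_mul_qInt, qDiff_mul_qInt, qDiff_mul_qInt,
    qDiff_mul_qInt, qDiff]
  push_cast
  simp only [sub_eq_add_neg, neg_add, neg_neg, qPow_add]
  ring

theorem genMatrix_Xp_mul_Xm (n : ℕ) : genMatrix n .Xp * genMatrix n .Xm
    = Matrix.diagonal fun j : Fin (n + 1) =>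
      qInt (((j : ℕ) : ℤ) + 1) * qInt ((n : ℤ) - ((j : ℕ) : ℤ)) := by
  ext1 i k
  rw [Matrix.mul_apply, Matrix.diagonal_apply]
  by_cases hi : (i : ℕ) < n
  · rw [Finset.sum_eq_single (⟨i + 1, by omega⟩ : Fin (n + 1))]
    · by_cases hik : i = k
      · subst hik
        simp only [genMatrix, Matrix.of_apply, if_true]
        rw [mul_comm]
        congr 2
        push_cast
        ring
      · have : ¬ (i : ℕ) + 1 = (k : ℕ) + 1 := fun h => hik (Fin.ext (by omega))
        simp only [genMatrix, Matrix.of_apply, if_neg hik, if_neg this, mul_zero]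
    · intro j _ hj
      have : ¬ (i : ℕ) + 1 = (j : ℕ) := fun h => hj (Fin.ext h.symm)
      simp only [genMatrix, Matrix.of_apply, if_neg this, zero_mul]
    · intro h; exact absurd (Finset.mem_univ _) h
  · rw [Finset.sum_eq_zero]
    · have : (n : ℤ) - ((i : ℕ) : ℤ) = 0 := by omega
      rw [this, qInt_zero, mul_zero, ite_self]
    · intro j _
      have : ¬ (i : ℕ) + 1 = (j : ℕ) := by omega
      simp only [genMatrix, Matrix.of_apply, if_neg this, zero_mul]

theorem genMatrix_Xm_mul_Xp (n : ℕ) : genMatrix n .Xm * genMatrix n .Xp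
    = Matrix.diagonal fun j : Fin (n + 1) =>
      qInt ((j : ℕ) : ℤ) * qInt ((n : ℤ) - ((j : ℕ) : ℤ) + 1) := by
  ext1 i k
  rw [Matrix.mul_apply, Matrix.diagonal_apply]
  by_cases hi : 0 < (i : ℕ)
  · rw [Finset.sum_eq_single (⟨i - 1, by omega⟩ : Fin (n + 1))]
    · have h1 : (i : ℕ) = (i : ℕ) - 1 + 1 := by omega
      by_cases hik : i = k
      · subst hik
        simp only [genMatrix, Matrix.of_apply, if_pos h1, if_pos h1.symm, if_true]
        congr 2
        · omega
        · ring
      · have : ¬ (i : ℕ) - 1 + 1 = (k : ℕ) := fun h => hik (Fin.ext (by omega))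
        simp only [genMatrix, Matrix.of_apply, if_neg hik, if_neg this, mul_zero]
    · intro j _ hj
      have : ¬ (i : ℕ) = (j : ℕ) + 1 := fun h => hj (Fin.ext (by simp only; omega))
      simp only [genMatrix, Matrix.of_apply, if_neg this, zero_mul]
    · intro h; exact absurd (Finset.mem_univ _) h
  · rw [Finset.sum_eq_zero]
    · have : ((i : ℕ) : ℤ) = 0 := by omega
      rw [this, qInt_zero, zero_mul, ite_self]
    · intro j _
      have : ¬ (i : ℕ) = (j : ℕ) + 1 := by omega
      simp only [genMatrix, Matrix.of_apply, if_neg this, zero_mul]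

/-- The matrices `genMatrix` satisfy the defining relations of `U_h(sl_2)`. -/
theorem freeAction_relIdeal (n : ℕ) : ∀ z ∈ relIdeal, freeAction n z = 0 := by
  have key : relIdeal ≤ TwoSidedIdeal.ker (freeAction n) := by
    rw [relIdeal, TwoSidedIdeal.span_le]
    rintro z (rfl | rfl | rfl) <;>
      simp only [SetLike.mem_coe, TwoSidedIdeal.mem_ker, map_sub, map_add, map_mul, freeAction_gen,
        freeAction_qIntH, map_ofNat]
    · ext1 i j
      simp only [genMatrix, two_mul, Matrix.sub_apply, Matrix.add_apply, Matrix.diagonal_mul,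
        Matrix.mul_diagonal, Matrix.of_apply, Matrix.zero_apply]
      split_ifs with h
      · rw [← h]
        push_cast
        simp only [map_sub, map_add, map_one]
        ring
      · ring
    · ext1 i j
      simp only [genMatrix, two_mul, Matrix.sub_apply, Matrix.add_apply, Matrix.diagonal_mul,
        Matrix.mul_diagonal, Matrix.of_apply, Matrix.zero_apply]
      split_ifs with h
      · rw [h]
        push_cast
        simp only [map_sub, map_add, map_one]
        ring
      · ring
    · rw [genMatrix_Xp_mul_Xm, genMatrix_Xm_mul_Xp, Matrix.diagonal_sub, Matrix.diagonal_sub,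
        Matrix.diagonal_eq_zero]
      funext j
      rw [qInt_identity, Pi.zero_apply, sub_eq_zero]
      congr 1
      ring
  intro z hz
  exact (TwoSidedIdeal.mem_ker _).mp (key hz)

theorem freeAction_closedRel (n : ℕ) ⦃x y : FreeTop⦄ (h : ClosedRel x y) :
    freeAction n x = freeAction n y :=
  evalHom_closedRel _ (freeAction_relIdeal n) h

/-- The action of `U_h(sl_2)` by matrices, induced by `freeAction`. -/
def matAction (n : ℕ) : Uh →ₐ[K] Matrix (Fin (n + 1)) (Fin (n + 1)) K :=
  RingQuot.liftAlgHom K ⟨freeAction n, freeAction_closedRel n⟩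

theorem matAction_of (n : ℕ) (g : Gen) : matAction n (Uh.of g) = genMatrix n g :=
  (RingQuot.liftAlgHom_mkAlgHom_apply K (freeAction n) (freeAction_closedRel n) (gen g)).trans
    (freeAction_gen n g)

/-- The structure of a `U_h(sl_2)`-module on `Ṽ_n`, as a homomorphism of `ℂ[[h]]`-algebras
`U_h(sl_2) → End(Ṽ_n)`. -/
def rho (n : ℕ) : Uh →ₐ[K] Module.End K (V n) :=
  (Matrix.toLinAlgEquiv' : Matrix (Fin (n + 1)) (Fin (n + 1)) K ≃ₐ[K] _).toAlgHom.comp (matAction n)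

theorem rho_of (n : ℕ) (g : Gen) : rho n (Uh.of g) = Matrix.toLin' (genMatrix n g) :=
  congrArg Matrix.toLin' (matAction_of n g)

/-- `v_i` for an arbitrary integer index, with `v_i = 0` unless `0 ≤ i ≤ n`. -/
def vec (n : ℕ) (i : ℤ) : V n := fun j => if ((j : ℕ) : ℤ) = i then 1 else 0

theorem vec_eq_vBasis (n : ℕ) (i : Fin (n + 1)) : vec n ((i : ℕ) : ℤ) = vBasis n i := by
  funext j
  simp [vec, vBasis, Pi.single_apply, Fin.ext_iff]

theorem rho_of_vBasis (n : ℕ) (g : Gen) (i j : Fin (n + 1)) :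
    rho n (Uh.of g) (vBasis n i) j = genMatrix n g j i := by
  rw [rho_of, vBasis, Pi.basisFun_apply, Matrix.toLin'_apply, Matrix.mulVec_single_one]
  rfl

theorem rho_H (n : ℕ) (i : Fin (n + 1)) :
    rho n (Uh.of .H) (vBasis n i) = ((n : K) - 2 * ((i : ℕ) : K)) • vBasis n i := by
  funext j
  rw [rho_of_vBasis, genMatrix, Matrix.diagonal_apply, Pi.smul_apply, vBasis, Pi.basisFun_apply,
    Pi.single_apply]
  split_ifs with h
  · subst h
    rw [smul_eq_mul, mul_one, map_sub, map_mul, map_natCast, map_natCast, map_ofNat]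
  · simp

theorem rho_Xp (n : ℕ) (i : Fin (n + 1)) : rho n (Uh.of .Xp) (vBasis n i)
    = qInt ((n : ℤ) + 1 - ((i : ℕ) : ℤ)) • vec n (((i : ℕ) : ℤ) - 1) := by
  funext j
  have h : ((j : ℕ) : ℤ) = ((i : ℕ) : ℤ) - 1 ↔ (j : ℕ) + 1 = (i : ℕ) := by omega
  rw [rho_of_vBasis, genMatrix, Matrix.of_apply, Pi.smul_apply, vec, smul_eq_mul, mul_ite, mul_one,
    mul_zero]
  simp only [h]

theorem rho_Xm (n : ℕ) (i : Fin (n + 1)) : rho n (Uh.of .Xm) (vBasis n i)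
    = qInt (((i : ℕ) : ℤ) + 1) • vec n (((i : ℕ) : ℤ) + 1) := by
  funext j
  have h : ((j : ℕ) : ℤ) = ((i : ℕ) : ℤ) + 1 ↔ (j : ℕ) = (i : ℕ) + 1 := by omega
  rw [rho_of_vBasis, genMatrix, Matrix.of_apply, Pi.smul_apply, vec, smul_eq_mul, mul_ite, mul_one,
    mul_zero]
  simp only [h]

/-! ### The action of the completed tensor square -/

/-- Finite free modules over `ℂ[[h]]` are `h`-adically complete. -/
instance isAdicComplete_hIdeal {M : Type} [AddCommGroup M] [Module K M] [Module.Free K M] [Module.Finite K M] :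
    IsAdicComplete hIdeal M where
  haus' := (IsHausdorff.of_le_jacobson hIdeal M (IsAdicComplete.le_jacobson_bot hIdeal)).haus'
  prec' f hf := by
    let b := Module.Free.chooseBasis K M
    have hc (l : M →ₗ[K] K) {k : ℕ} {x y : M} (h : x ≡ y [SMOD (hIdeal ^ k • ⊤ : Submodule K M)]) :
        l x ≡ l y [SMOD (hIdeal ^ k • ⊤ : Submodule K K)] := by
      rw [SModEq.sub_mem] at h ⊢
      rw [← map_sub]
      have := Submodule.mem_map_of_mem (f := l) h
      rw [Submodule.map_smul''] at this
      exact Submodule.smul_mono le_rfl le_top this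
    have hl (i) := IsPrecomplete.prec (I := hIdeal) (M := K) inferInstance
      (f := fun k => b.coord i (f k)) (fun {m k} hmk => hc _ (hf hmk))
    choose L hL using hl
    refine ⟨∑ i, L i • b i, fun k => ?_⟩
    rw [SModEq.sub_mem]
    have e : f k - ∑ i, L i • b i = ∑ i, (b.coord i (f k) - L i) • b i := by
      simp_rw [sub_smul, Finset.sum_sub_distrib]
      rw [← b.sum_repr (f k)]
      simp
    rw [e]
    refine Submodule.sum_mem _ fun i _ => ?_
    refine Submodule.smul_mem_smul ?_ trivial
    have := SModEq.sub_mem.mp (hL i k)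
    simpa using this

/-- The extension by `h`-adic continuity of a linear map into a finite free `ℂ[[h]]`-module to the
`h`-adic completion. -/
def extendToCompletion {T E : Type} [AddCommGroup T] [Module K T] [AddCommGroup E] [Module K E]
    [Module.Free K E] [Module.Finite K E] (f : T →ₗ[K] E) : AdicCompletion hIdeal T →ₗ[K] E :=
  (AdicCompletion.ofLinearEquiv hIdeal E).symm.toLinearMap ∘ₗ
    (AdicCompletion.map hIdeal f).restrictScalars K

theorem extendToCompletion_of {T E : Type} [AddCommGroup T] [Module K T] [AddCommGroup E]
    [Module K E] [Module.Free K E] [Module.Finite K E] (f : T →ₗ[K] E) (x : T) :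
    extendToCompletion f (AdicCompletion.of hIdeal T x) = f x := by
  rw [extendToCompletion, LinearMap.comp_apply, LinearMap.restrictScalars_apply,
    AdicCompletion.map_of, LinearEquiv.coe_coe, LinearEquiv.symm_apply_eq,
    AdicCompletion.ofLinearEquiv_apply]

/-- The value on the class of a Cauchy sequence `x` is the `h`-adic limit of the `f (x N)`. -/
theorem extendToCompletion_mk {T E : Type} [AddCommGroup T] [Module K T] [AddCommGroup E]
    [Module K E] [Module.Free K E] [Module.Finite K E] (f : T →ₗ[K] E)
    (x : AdicCompletion.AdicCauchySequence hIdeal T) (N : ℕ) :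
    extendToCompletion f (AdicCompletion.mk hIdeal T x) ≡ f (x N)
      [SMOD (hIdeal ^ N • ⊤ : Submodule K E)] := by
  have h : AdicCompletion.of hIdeal E (extendToCompletion f (AdicCompletion.mk hIdeal T x))
      = AdicCompletion.mk hIdeal E (AdicCompletion.AdicCauchySequence.map hIdeal f x) := by
    rw [extendToCompletion, LinearMap.comp_apply, LinearMap.restrictScalars_apply,
      AdicCompletion.map_mk, LinearEquiv.coe_coe, ← AdicCompletion.ofLinearEquiv_apply,
      LinearEquiv.apply_symm_apply]
  have h' := congrArg (AdicCompletion.eval hIdeal E N) h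
  exact h'

/-- The action of the (uncompleted) tensor square on `Ṽ_n ⊗ Ṽ_n`:
`u ⊗ w` acts as `ρ(u) ⊗ ρ(w)`. -/
def tensorAction (n : ℕ) : Uh ⊗[K] Uh →ₗ[K] Module.End K (V n ⊗[K] V n) :=
  TensorProduct.homTensorHomMap (RingHom.id K) (V n) (V n) (V n) (V n) ∘ₗ
    TensorProduct.map (rho n).toLinearMap (rho n).toLinearMap

theorem tensorAction_tmul (n : ℕ) (u w : Uh) :
    tensorAction n (u ⊗ₜ[K] w) = TensorProduct.map (rho n u) (rho n w) := rfl

/-- The action of the completed tensor square on `Ṽ_n ⊗ Ṽ_n`: the extension of `tensorAction` by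
`h`-adic continuity, `End(Ṽ_n ⊗ Ṽ_n)` being `h`-adically complete. -/
def completedAction (n : ℕ) : UhTensor →ₗ[K] Module.End K (V n ⊗[K] V n) :=
  extendToCompletion (T := Uh ⊗[K] Uh) (E := Module.End K (V n ⊗[K] V n))
    (tensorAction n)

theorem completedAction_of (n : ℕ) (x : Uh ⊗[K] Uh) :
    completedAction n (AdicCompletion.of hIdeal _ x) = tensorAction n x :=
  extendToCompletion_of (T := Uh ⊗[K] Uh) (E := Module.End K (V n ⊗[K] V n)) _ _

theorem completedAction_universalR (n N : ℕ) :
    completedAction n universalR ≡ tensorAction n (rPartial N)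
      [SMOD (hIdeal ^ N • ⊤ : Submodule K (Module.End K (V n ⊗[K] V n)))] :=
  extendToCompletion_mk (T := Uh ⊗[K] Uh) (E := Module.End K (V n ⊗[K] V n)) _ _ N

/-! ### The operators `B` and `B_α` -/

/-- `γ = e^{2c}`. -/
def gammaOf (c : ℂ) : ℂ := Complex.exp (2 * c)

/-- The automorphism `α(v_i) = γ^{-i} v_i` of `Ṽ_n`, where `γ = e^{2c}`. -/
def alphaV (n : ℕ) (c : ℂ) : V n →ₗ[K] V n :=
  (vBasis n).constr K fun i => (PowerSeries.C ((gammaOf c)⁻¹ ^ (i : ℕ)) : K) • vBasis n i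

/-- The operator `B = τ ∘ R` on `Ṽ_n ⊗ Ṽ_n`. -/
def BR (n : ℕ) : V n ⊗[K] V n →ₗ[K] V n ⊗[K] V n :=
  (TensorProduct.comm K (V n) (V n)).toLinearMap ∘ₗ completedAction n universalR

/-- The operator `B_α = α^{⊗ 2} ∘ τ ∘ R` on `Ṽ_n ⊗ Ṽ_n`. -/
def BAlpha (n : ℕ) (c : ℂ) : V n ⊗[K] V n →ₗ[K] V n ⊗[K] V n :=
  TensorProduct.map (alphaV n c) (alphaV n c) ∘ₗ BR n

/-- The ordered basis `v_0 ⊗ v_0, v_0 ⊗ v_1, v_1 ⊗ v_0, v_1 ⊗ v_1` of `Ṽ_1 ⊗ Ṽ_1`. -/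
def tensorBasis : Module.Basis (Fin 4) K (V 1 ⊗[K] V 1) :=
  ((vBasis 1).tensorProduct (vBasis 1)).reindex (finProdFinEquiv (m := 2) (n := 2))

theorem tensorBasis_eq : ⇑tensorBasis =
    ![vBasis 1 0 ⊗ₜ vBasis 1 0, vBasis 1 0 ⊗ₜ vBasis 1 1,
      vBasis 1 1 ⊗ₜ vBasis 1 0, vBasis 1 1 ⊗ₜ vBasis 1 1] := by
  funext i
  rw [tensorBasis, Module.Basis.reindex_apply, Module.Basis.tensorProduct_apply]
  fin_cases i <;> rfl

/-- `B` is a solution of the Hom-Yang-Baxter equation for `(M, α)`: `B` commutes with `α ⊗ α`, and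
`(α ⊗ B)(B ⊗ α)(α ⊗ B) = (B ⊗ α)(α ⊗ B)(B ⊗ α)`. -/
def IsHYBESolution {k M : Type*} [CommRing k] [AddCommGroup M] [Module k M]
    (α : M →ₗ[k] M) (B : M ⊗[k] M →ₗ[k] M ⊗[k] M) : Prop :=
  let αB : M ⊗[k] (M ⊗[k] M) →ₗ[k] M ⊗[k] (M ⊗[k] M) := TensorProduct.map α B
  let Bα : M ⊗[k] (M ⊗[k] M) →ₗ[k] M ⊗[k] (M ⊗[k] M) :=
    (TensorProduct.assoc k M M M).toLinearMap ∘ₗ TensorProduct.map B α ∘ₗ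
      (TensorProduct.assoc k M M M).symm.toLinearMap
  B ∘ₗ TensorProduct.map α α = TensorProduct.map α α ∘ₗ B ∧
    αB ∘ₗ Bα ∘ₗ αB = Bα ∘ₗ αB ∘ₗ Bα

/-- `B` is a solution of the Yang-Baxter equation
`(B ⊗ Id)(Id ⊗ B)(B ⊗ Id) = (Id ⊗ B)(B ⊗ Id)(Id ⊗ B)`. -/
def IsYBESolution {k M : Type*} [CommRing k] [AddCommGroup M] [Module k M]
    (B : M ⊗[k] M →ₗ[k] M ⊗[k] M) : Prop :=
  IsHYBESolution LinearMap.id B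

end HomQuantum

end

/-!
On a tensor product of weight vectors the exponential factor of the universal `R`-matrix acts by a
scalar: if `H v = x v` and `H w = y w`, then `exp((h/4) (H ⊗ H + a (H ⊗ 1 - 1 ⊗ H)))` multiplies
`v ⊗ w` by `q^{(x y + a (x - y)) / 2}`. On `Ṽ_1` the square of `X_+` is zero, so only the terms
`a = 0` and `a = 1` of the series contribute, and since `[1]_q = 1` the coefficient of the second
is `(q - q⁻¹) q⁻¹`. This gives the values of `R` on the four basis vectors (`universalR_apply`), and
hence both matrices. Because the action of the completed tensor square is defined by `h`-adic
continuity, the value is found from the truncated sums `rPartial N`, by comparing modulo `h ^ N`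
for all large `N` (`completedAction_universalR_eq`).

The Hom-Yang-Baxter equation is then a computation on the eight basis vectors of
`Ṽ_1 ⊗ Ṽ_1 ⊗ Ṽ_1`, valid over every commutative ring and for every `α = diag(1, g)`, in which only
`q q⁻¹ = 1` is used (`IsHYBESolution.of_basis`). The Yang-Baxter equation for `B` is the case
`c = 0`, where `α` is the identity.
-/

noncomputable section

namespace HomQuantum

/-! ### A Hom-Yang-Baxter operator of rank two -/

/-- The operator with matrix
`s (q, 0, 0, 0; 0, 0, g, 0; 0, g, g (q - q⁻¹), 0; 0, 0, 0, g² q)` on the tensor square of a free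
module of rank two solves the Hom-Yang-Baxter equation for `α = diag(1, g)`.
Here `p` stands for `q⁻¹`. -/
theorem IsHYBESolution.of_basis {k M : Type*} [CommRing k] [AddCommGroup M] [Module k M]
    (b : Module.Basis (Fin 2) k M) {α : M →ₗ[k] M} {B : M ⊗[k] M →ₗ[k] M ⊗[k] M} {s q p g : k}
    (hqp : q * p = 1) (hα₀ : α (b 0) = b 0) (hα₁ : α (b 1) = g • b 1)
    (h₀₀ : B (b 0 ⊗ₜ b 0) = (s * q) • (b 0 ⊗ₜ b 0))
    (h₀₁ : B (b 0 ⊗ₜ b 1) = (s * g) • (b 1 ⊗ₜ b 0))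
    (h₁₀ : B (b 1 ⊗ₜ b 0) = (s * g) • (b 0 ⊗ₜ b 1) + (s * (g * (q - p))) • (b 1 ⊗ₜ b 0))
    (h₁₁ : B (b 1 ⊗ₜ b 1) = (s * (g ^ 2 * q)) • (b 1 ⊗ₜ b 1)) :
    IsHYBESolution α B := by
  refine ⟨(b.tensorProduct b).ext ?_, (b.tensorProduct (b.tensorProduct b)).ext ?_⟩
  · rintro ⟨i, j⟩
    fin_cases i <;> fin_cases j <;>
      simp [hα₀, hα₁, h₀₀, h₀₁, h₁₀, h₁₁, TensorProduct.tmul_smul, ← TensorProduct.smul_tmul'] <;>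
      module
  -- In coordinates, the braid relation is polynomial in `s, q, p, g`, modulo `q p = 1`.
  · rintro ⟨i, j, l⟩
    fin_cases i <;> fin_cases j <;> fin_cases l <;>
      simp [hα₀, hα₁, h₀₀, h₀₁, h₁₀, h₁₁, TensorProduct.tmul_smul,
        TensorProduct.add_tmul, TensorProduct.tmul_add, ← TensorProduct.smul_tmul'] <;>
      match_scalars <;> grind

/-! ### Truncations of `R` on weight vectors -/

theorem tensorAction_eq (n : ℕ) (x : Uh ⊗[K] Uh) :
    tensorAction n x = Module.endTensorEndAlgHom (A := K) (R := K) (S := K)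
      (Algebra.TensorProduct.map (rho n) (rho n) x) := by
  induction x with
  | zero => simp
  | tmul u w => rfl
  | add x y hx hy => rw [map_add, map_add, map_add, hx, hy]

theorem tensorAction_mul (n : ℕ) (x y : Uh ⊗[K] Uh) :
    tensorAction n (x * y) = tensorAction n x * tensorAction n y := by
  simp only [tensorAction_eq, map_mul]

theorem tensorAction_one (n : ℕ) : tensorAction n 1 = 1 := by
  rw [Algebra.TensorProduct.one_def, tensorAction_tmul, map_one]
  exact TensorProduct.map_id

theorem smul_add_smul_sub_smul {k M : Type*} [CommRing k] [AddCommGroup M] [Module k M]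
    (r s t u : k) (m : M) : r • m + s • (t • m - u • m) = (r + s * (t - u)) • m := by
  module

theorem tensorAction_rExponent_apply {n a : ℕ} {v w : V n} {x y : ℂ}
    (hv : rho n (Uh.of .H) v = PowerSeries.C x • v)
    (hw : rho n (Uh.of .H) w = PowerSeries.C y • w) :
    tensorAction n (rExponent a) (v ⊗ₜ w)
      = (PowerSeries.C (x * y + a * (x - y)) : K) • (v ⊗ₜ[K] w) := by
  rw [rExponent, ← Nat.cast_smul_eq_nsmul K, map_add, map_smul, map_sub, LinearMap.add_apply,
    LinearMap.smul_apply, LinearMap.sub_apply]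
  simp only [tensorAction_tmul, TensorProduct.map_tmul, hv, hw, map_one, Module.End.one_apply,
    TensorProduct.tmul_smul, ← TensorProduct.smul_tmul', smul_smul]
  refine (smul_add_smul_sub_smul _ _ _ _ _).trans ?_
  congr 1
  simp only [map_add, map_mul, map_sub, map_natCast]
  ring

/-- The sum of the first `N` terms of the series `exp(h z / 4) = q^{z / 2}`. -/
def expPartial (z : ℂ) (N : ℕ) : K :=
  ∑ m ∈ Finset.range N,
    PowerSeries.X ^ m * PowerSeries.C (1 / (4 ^ m * (m.factorial : ℂ))) * PowerSeries.C z ^ m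

theorem X_pow_dvd_expPartial_sub (z : ℂ) (N : ℕ) :
    (PowerSeries.X : K) ^ N ∣ expPartial z N - qPow (z / 2) := by
  rw [PowerSeries.X_pow_dvd_iff]
  intro m hm
  have e (k : ℕ) : (PowerSeries.X ^ k * PowerSeries.C (1 / (4 ^ k * (k.factorial : ℂ))) *
      PowerSeries.C z ^ k : K) =
      PowerSeries.X ^ k * PowerSeries.C (1 / (4 ^ k * (k.factorial : ℂ)) * z ^ k) := by
    rw [map_mul, map_pow, mul_assoc]
  simp only [expPartial, map_sub, map_sum, coeff_qPow, e, PowerSeries.coeff_X_pow_mul',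
    PowerSeries.coeff_C]
  rw [Finset.sum_eq_single m (fun k _ hk => ?_) (fun h => absurd (Finset.mem_range.mpr hm) h)]
  · simp only [le_refl, if_true, Nat.sub_self]
    rw [sub_eq_zero, div_div, div_pow]
    norm_num
    ring
  · split_ifs <;> first | rfl | omega

theorem tensorAction_rExpPartial_apply {n a : ℕ} {v w : V n} {x y : ℂ} (N : ℕ)
    (hv : rho n (Uh.of .H) v = PowerSeries.C x • v)
    (hw : rho n (Uh.of .H) w = PowerSeries.C y • w) :
    tensorAction n (rExpPartial a N) (v ⊗ₜ w)
      = expPartial (x * y + a * (x - y)) N • (v ⊗ₜ[K] w) := by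
  have hp (m : ℕ) : tensorAction n (rExponent a ^ m) (v ⊗ₜ w)
      = (PowerSeries.C (x * y + a * (x - y)) : K) ^ m • (v ⊗ₜ[K] w) := by
    induction m with
    | zero => simp [tensorAction_one]
    | succ m ih =>
      rw [pow_succ, tensorAction_mul, Module.End.mul_apply, tensorAction_rExponent_apply hv hw,
        map_smul, ih, smul_smul, pow_succ']
  simp only [rExpPartial, map_sum, map_smul, LinearMap.sum_apply,
    LinearMap.smul_apply, hp, smul_smul, expPartial, Finset.sum_smul]

/-! ### The value of `R` on weight vectors -/

/-- The value of `R` at a vector is the `h`-adic limit of the values of the truncations. -/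
theorem completedAction_universalR_eq {n : ℕ} {v w : V n ⊗[K] V n} (N₀ : ℕ)
    (h : ∀ N, N₀ ≤ N → tensorAction n (rPartial N) v ≡ w
      [SMOD (hIdeal ^ N • ⊤ : Submodule K (V n ⊗[K] V n))]) :
    completedAction n universalR v = w := by
  rw [← sub_eq_zero]
  refine IsHausdorff.haus (I := hIdeal) inferInstance _ fun N => ?_
  rw [SModEq.sub_mem, sub_zero, ← SModEq.sub_mem]
  have hN : (hIdeal ^ max N N₀ • ⊤ : Submodule K (V n ⊗[K] V n)) ≤ hIdeal ^ N • ⊤ :=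
    Submodule.smul_mono (Ideal.pow_le_pow_right (le_max_left _ _)) le_rfl
  refine SModEq.mono hN (SModEq.trans ?_ (h _ (le_max_right _ _)))
  have := completedAction_universalR n (max N N₀)
  rw [SModEq.sub_mem] at this ⊢
  rw [← LinearMap.sub_apply]
  have h2 := Submodule.mem_map_of_mem (f := LinearMap.applyₗ (R := K) v) this
  rw [Submodule.map_smul''] at h2
  exact Submodule.smul_mono le_rfl le_top h2

theorem qInt_one : qInt 1 = 1 := by
  refine mul_left_cancel₀ qDiff_ne_zero ?_
  rw [qDiff_mul_qInt, mul_one, qDiff]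
  simp

theorem rCoeff_zero : rCoeff 0 = 1 := by
  simp [rCoeff, qFact, qPow_zero]

theorem rCoeff_one : rCoeff 1 = qDiff * qPow (-1) := by
  have : -((1 : ℕ) * ((1 : ℕ) + 1) / 2 : ℂ) = -1 := by norm_num
  rw [rCoeff, this]
  simp [qFact, qInt_one]

theorem smul_smodEq_of_dvd {M : Type*} [AddCommGroup M] [Module K M] {N : ℕ} {c d : K}
    (h : (PowerSeries.X : K) ^ N ∣ c - d) (m : M) :
    c • m ≡ d • m [SMOD (hIdeal ^ N • ⊤ : Submodule K M)] := by
  rw [SModEq.sub_mem, ← sub_smul]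
  refine Submodule.smul_mem_smul ?_ trivial
  rwa [hIdeal, Ideal.span_singleton_pow, Ideal.mem_span_singleton]

theorem tensorAction_rPartial_apply (n N : ℕ) (v w : V n) :
    tensorAction n (rPartial N) (v ⊗ₜ w) = ∑ a ∈ Finset.range N, rCoeff a •
      tensorAction n (rExpPartial a N)
        ((rho n (Uh.of .Xp) ^ a) v ⊗ₜ (rho n (Uh.of .Xm) ^ a) w) := by
  simp only [rPartial, map_sum, map_smul, LinearMap.sum_apply, LinearMap.smul_apply,
    tensorAction_mul, Module.End.mul_apply, tensorAction_tmul, TensorProduct.map_tmul, map_pow]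

/-- The action of `R` on `v ⊗ w`, for weight vectors with `X_+^2 v = 0`. The vectors `v' = X_+ v` and
`w' = X_- w` may be zero, in which case `x'` and `y'` are arbitrary. -/
theorem universalR_apply {n : ℕ} {v w v' w' : V n} {x y x' y' : ℂ}
    (hv : rho n (Uh.of .H) v = PowerSeries.C x • v)
    (hw : rho n (Uh.of .H) w = PowerSeries.C y • w)
    (hv' : rho n (Uh.of .H) v' = PowerSeries.C x' • v')
    (hw' : rho n (Uh.of .H) w' = PowerSeries.C y' • w')
    (hXv : rho n (Uh.of .Xp) v = v') (hXw : rho n (Uh.of .Xm) w = w')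
    (hXv' : rho n (Uh.of .Xp) v' = 0) :
    completedAction n universalR (v ⊗ₜ w) = qPow (x * y / 2) • (v ⊗ₜ[K] w) +
      (qDiff * qPow (-1) * qPow ((x' * y' + (x' - y')) / 2)) • (v' ⊗ₜ[K] w') := by
  -- Truncations of order at least two contain both of the terms `a = 0, 1` that contribute.
  refine completedAction_universalR_eq 2 fun N hN => ?_
  obtain ⟨d, rfl⟩ := Nat.exists_eq_add_of_le hN
  have hzero (a : ℕ) : (rho n (Uh.of .Xp) ^ (2 + a)) v = 0 := by
    have h := pow_add (rho n (Uh.of .Xp)) a 2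
    rw [add_comm a, pow_two] at h
    rw [h, Module.End.mul_apply, Module.End.mul_apply, hXv, hXv', map_zero]
  rw [tensorAction_rPartial_apply, Finset.sum_range_add]
  simp only [hzero, TensorProduct.zero_tmul, map_zero, smul_zero, Finset.sum_const_zero, add_zero,
    Finset.sum_range_succ, Finset.sum_range_zero, zero_add, pow_zero, pow_one,
    Module.End.one_apply, hXv, hXw, rCoeff_zero, rCoeff_one, one_smul,
    tensorAction_rExpPartial_apply _ hv hw, tensorAction_rExpPartial_apply _ hv' hw']
  rw [mul_smul _ _ (v' ⊗ₜ[K] w')]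
  refine SModEq.add (smul_smodEq_of_dvd ?_ _) (SModEq.smul (smul_smodEq_of_dvd ?_ _) _)
  · simpa using X_pow_dvd_expPartial_sub (x * y + (0 : ℕ) * (x - y)) (2 + d)
  · simpa using X_pow_dvd_expPartial_sub (x' * y' + (1 : ℕ) * (x' - y')) (2 + d)

/-! ### The module `Ṽ_1` -/

theorem vec_one_zero : vec 1 0 = vBasis 1 0 := vec_eq_vBasis 1 0

theorem vec_one_one : vec 1 1 = vBasis 1 1 := vec_eq_vBasis 1 1

theorem rho_one_H_zero :
    rho 1 (Uh.of .H) (vBasis 1 0) = (PowerSeries.C (1 : ℂ) : K) • vBasis 1 0 := by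
  rw [rho_H]
  simp

theorem rho_one_H_one :
    rho 1 (Uh.of .H) (vBasis 1 1) = (PowerSeries.C (-1 : ℂ) : K) • vBasis 1 1 := by
  rw [rho_H]
  congr 1
  simp
  norm_num

theorem rho_one_Xp_zero : rho 1 (Uh.of .Xp) (vBasis 1 0) = 0 := by
  rw [rho_Xp]
  ext1 j
  fin_cases j <;> simp [vec]

theorem rho_one_Xp_one : rho 1 (Uh.of .Xp) (vBasis 1 1) = vBasis 1 0 := by
  rw [rho_Xp]
  simp [qInt_one, vec_one_zero]

theorem rho_one_Xm_zero : rho 1 (Uh.of .Xm) (vBasis 1 0) = vBasis 1 1 := by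
  rw [rho_Xm]
  simp [qInt_one, vec_one_one]

theorem rho_one_Xm_one : rho 1 (Uh.of .Xm) (vBasis 1 1) = 0 := by
  rw [rho_Xm]
  ext1 j
  fin_cases j <;> simp [vec]

/-- The zero vector counts as a weight vector of weight `0`. -/
theorem rho_H_zero (n : ℕ) : rho n (Uh.of .H) 0 = (PowerSeries.C (0 : ℂ) : K) • (0 : V n) := by
  rw [map_zero, smul_zero]

theorem qPow_half_eq : qPow (1 / 2) = qPow (-1 / 2) * qPow 1 := by
  rw [← qPow_add]
  norm_num

/-! ### The operators `B` and `B_α` on the basis -/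

theorem BR_zero_zero : BR 1 (vBasis 1 0 ⊗ₜ vBasis 1 0)
    = (qPow (-1 / 2) * qPow 1) • (vBasis 1 0 ⊗ₜ[K] vBasis 1 0) := by
  rw [BR, LinearMap.comp_apply, universalR_apply rho_one_H_zero rho_one_H_zero (rho_H_zero 1)
    rho_one_H_one rho_one_Xp_zero rho_one_Xm_zero (map_zero _)]
  simp only [TensorProduct.zero_tmul, smul_zero, add_zero, map_smul, LinearEquiv.coe_coe,
    TensorProduct.comm_tmul, mul_one, qPow_half_eq]

theorem BR_zero_one : BR 1 (vBasis 1 0 ⊗ₜ vBasis 1 1)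
    = qPow (-1 / 2) • (vBasis 1 1 ⊗ₜ[K] vBasis 1 0) := by
  rw [BR, LinearMap.comp_apply, universalR_apply rho_one_H_zero rho_one_H_one (rho_H_zero 1)
    (rho_H_zero 1) rho_one_Xp_zero rho_one_Xm_one (map_zero _)]
  simp only [TensorProduct.zero_tmul, smul_zero, add_zero, map_smul, LinearEquiv.coe_coe,
    TensorProduct.comm_tmul, one_mul]

theorem BR_one_zero : BR 1 (vBasis 1 1 ⊗ₜ vBasis 1 0)
    = qPow (-1 / 2) • (vBasis 1 0 ⊗ₜ[K] vBasis 1 1)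
      + (qPow (-1 / 2) * (qPow 1 - qPow (-1))) • (vBasis 1 1 ⊗ₜ[K] vBasis 1 0) := by
  have h : qPow (-1) * qPow ((1 * -1 + (1 - -1)) / 2) = qPow (-1 / 2) := by
    rw [← qPow_add]
    norm_num
  rw [BR, LinearMap.comp_apply, universalR_apply rho_one_H_one rho_one_H_zero rho_one_H_zero
    rho_one_H_one rho_one_Xp_one rho_one_Xm_zero rho_one_Xp_zero, mul_assoc, h, mul_comm qDiff]
  simp only [map_add, map_smul, LinearEquiv.coe_coe, TensorProduct.comm_tmul, mul_one, qDiff]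

theorem BR_one_one : BR 1 (vBasis 1 1 ⊗ₜ vBasis 1 1)
    = (qPow (-1 / 2) * qPow 1) • (vBasis 1 1 ⊗ₜ[K] vBasis 1 1) := by
  rw [BR, LinearMap.comp_apply, universalR_apply rho_one_H_one rho_one_H_one rho_one_H_zero
    (rho_H_zero 1) rho_one_Xp_one rho_one_Xm_one rho_one_Xp_zero]
  simp only [TensorProduct.tmul_zero, smul_zero, add_zero, map_smul, LinearEquiv.coe_coe,
    TensorProduct.comm_tmul, mul_neg, mul_one, neg_neg, qPow_half_eq]

theorem alphaV_vBasis (n : ℕ) (c : ℂ) (i : Fin (n + 1)) : alphaV n c (vBasis n i)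
    = (PowerSeries.C (gammaOf c)⁻¹ : K) ^ (i : ℕ) • vBasis n i := by
  rw [alphaV, Module.Basis.constr_basis, map_pow]

theorem alphaV_zero (n : ℕ) : alphaV n 0 = LinearMap.id :=
  (vBasis n).ext fun i => by simp [alphaV_vBasis, gammaOf]

theorem BAlpha_zero (n : ℕ) : BAlpha n 0 = BR n := by
  rw [BAlpha, alphaV_zero, TensorProduct.map_id, LinearMap.id_comp]

theorem BAlpha_zero_zero (c : ℂ) : BAlpha 1 c (vBasis 1 0 ⊗ₜ vBasis 1 0)
    = (qPow (-1 / 2) * qPow 1) • (vBasis 1 0 ⊗ₜ[K] vBasis 1 0) := by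
  simp [BAlpha, BR_zero_zero, alphaV_vBasis]

theorem BAlpha_zero_one (c : ℂ) : BAlpha 1 c (vBasis 1 0 ⊗ₜ vBasis 1 1)
    = (qPow (-1 / 2) * PowerSeries.C (gammaOf c)⁻¹) • (vBasis 1 1 ⊗ₜ[K] vBasis 1 0) := by
  simp [BAlpha, BR_zero_one, alphaV_vBasis, ← TensorProduct.smul_tmul', smul_smul]

theorem BAlpha_one_zero (c : ℂ) : BAlpha 1 c (vBasis 1 1 ⊗ₜ vBasis 1 0)
    = (qPow (-1 / 2) * PowerSeries.C (gammaOf c)⁻¹) • (vBasis 1 0 ⊗ₜ[K] vBasis 1 1)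
      + (qPow (-1 / 2) * (PowerSeries.C (gammaOf c)⁻¹ * (qPow 1 - qPow (-1)))) •
        (vBasis 1 1 ⊗ₜ[K] vBasis 1 0) := by
  simp only [BAlpha, LinearMap.comp_apply, BR_one_zero, map_add, map_smul, TensorProduct.map_tmul,
    alphaV_vBasis, ← TensorProduct.smul_tmul', TensorProduct.tmul_smul, smul_smul, Fin.val_zero,
    Fin.val_one, pow_zero, pow_one, one_smul]
  congr 2
  ring

theorem BAlpha_one_one (c : ℂ) : BAlpha 1 c (vBasis 1 1 ⊗ₜ vBasis 1 1)
    = (qPow (-1 / 2) * (PowerSeries.C (gammaOf c)⁻¹ ^ 2 * qPow 1)) •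
      (vBasis 1 1 ⊗ₜ[K] vBasis 1 1) := by
  simp only [BAlpha, LinearMap.comp_apply, BR_one_one, map_smul, TensorProduct.map_tmul,
    alphaV_vBasis, ← TensorProduct.smul_tmul', TensorProduct.tmul_smul, smul_smul, Fin.val_one,
    pow_one]
  congr 1
  ring

theorem isHYBESolution_BAlpha (c : ℂ) : IsHYBESolution (alphaV 1 c) (BAlpha 1 c) :=
  .of_basis (vBasis 1) (by rw [← qPow_add, add_neg_cancel, qPow_zero])
    (by simp [alphaV_vBasis]) (by simp [alphaV_vBasis])
    (BAlpha_zero_zero c) (BAlpha_zero_one c) (BAlpha_one_zero c) (BAlpha_one_one c)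

theorem toMatrix_BAlpha (c : ℂ) :
    LinearMap.toMatrix tensorBasis tensorBasis (BAlpha 1 c) =
      qPow (-1 / 2) •
        !![qPow 1, 0, 0, 0;
           0, 0, PowerSeries.C (gammaOf c)⁻¹, 0;
           0, PowerSeries.C (gammaOf c)⁻¹,
             PowerSeries.C (gammaOf c)⁻¹ * (qPow 1 - qPow (-1)), 0;
           0, 0, 0, PowerSeries.C ((gammaOf c)⁻¹ ^ 2) * qPow 1] := by
  rw [map_pow, ← LinearEquiv.eq_symm_apply, LinearMap.toMatrix_symm]
  refine tensorBasis.ext fun i => ?_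
  rw [Matrix.toLin_self, tensorBasis_eq]
  fin_cases i <;>
    simp [Fin.sum_univ_four, BAlpha_zero_zero, BAlpha_zero_one, BAlpha_one_zero, BAlpha_one_one,
      -map_inv₀]

end HomQuantum

end

theorem mainTheorem10 :
    (∀ c : ℂ,
      HomQuantum.IsHYBESolution (HomQuantum.alphaV 1 c) (HomQuantum.BAlpha 1 c) ∧
      LinearMap.toMatrix HomQuantum.tensorBasis HomQuantum.tensorBasis (HomQuantum.BAlpha 1 c) =
        HomQuantum.qPow (-1 / 2) •
          !![HomQuantum.qPow 1, 0, 0, 0;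
             0, 0, PowerSeries.C (HomQuantum.gammaOf c)⁻¹, 0;
             0, PowerSeries.C (HomQuantum.gammaOf c)⁻¹,
               PowerSeries.C (HomQuantum.gammaOf c)⁻¹ *
                 (HomQuantum.qPow 1 - HomQuantum.qPow (-1)), 0;
             0, 0, 0, PowerSeries.C ((HomQuantum.gammaOf c)⁻¹ ^ 2) * HomQuantum.qPow 1]) ∧
    HomQuantum.BAlpha 1 0 = HomQuantum.BR 1 ∧
    HomQuantum.IsYBESolution (HomQuantum.BR 1) ∧
    LinearMap.toMatrix HomQuantum.tensorBasis HomQuantum.tensorBasis (HomQuantum.BR 1) =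
      HomQuantum.qPow (-1 / 2) •
        !![HomQuantum.qPow 1, 0, 0, 0;
           0, 0, 1, 0;
           0, 1, HomQuantum.qPow 1 - HomQuantum.qPow (-1), 0;
           0, 0, 0, HomQuantum.qPow 1] := by
  refine ⟨fun c => ⟨HomQuantum.isHYBESolution_BAlpha c, HomQuantum.toMatrix_BAlpha c⟩,
    HomQuantum.BAlpha_zero 1, ?_, ?_⟩
  · have h := HomQuantum.isHYBESolution_BAlpha 0
    rwa [HomQuantum.alphaV_zero, HomQuantum.BAlpha_zero] at h
  · have h := HomQuantum.toMatrix_BAlpha 0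
    rw [HomQuantum.BAlpha_zero] at h
    simpa [HomQuantum.gammaOf] using h
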